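/- Let $K$ be an algebraically closed field of characteristic zero. The index of a finite-dimensional Lie algebra $\mathfrak g$ over $K$ is $$\operatorname{ind}\mathfrak g=\min_{f\in\mathfrak g^*}\dim\ker B_f,\qquad B_f(x,y)=f([x,y]).$$ For two compositions $a=(a_1,\dots,a_m)$ and $b=(b_1,\dots,b_t)$ of a positive integer $n$, the seaweed $\mathfrak p_n(a,b)$ with top composition $a$ and bottom composition $b$ is the Lie subalgebra of $\mathfrak{sl}(n)=\mathfrak{sl}_n(K)$ consisting of all traceless matrices that preserve every subspace $V_i=\operatorname{span}\{e_1,\dots,e_{a_1+\cdots+a_i}\}$ $(0\le i\le m)$ and every subspace $W_j=\operatorname{span}\{e_{b_1+\cdots+b_j+1},\dots,e_n\}$ $(0\le j\le t)$ of $K^n$, where $e_1,\dots,e_n$ is the standard basis. Let $C(n,k)$ be the number of ordered pairs $(a,b)$ of compositions of $n$ such that $\mathfrak p_n(a,b)$ has index $k$. Then, for every $n\ge 1$ and all compositions $a,b$ of $n$, the seaweed $\mathfrak p_n(a,b)$ has index $n-1$ if and only if $a=b$. Consequently $C(n,n-1)=2^{n-1}$ for every $n\ge 1$, and, as formal power series,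 $$\sum_{n>0}C(n,n-1)\,x^n=\frac{x}{1-2x}.$$ -/

import Mathlib

noncomputable section

/-- The Kirillov form `B_f(x, y) = f ⁅x, y⁆` of a linear form `f` on a Lie algebra `L`. -/
def kirillovForm {K L : Type*} [Field K] [LieRing L] [LieAlgebra K L] (f : Module.Dual K L) :
    L →ₗ[K] L →ₗ[K] K :=
  LinearMap.mk₂ K (fun x y => f ⁅x, y⁆)
    (fun x₁ x₂ y => by simp) (fun c x y => by simp)
    (fun x y₁ y₂ => by simp) (fun c x y => by simp)

/-- The index of a (finite dimensional) Lie algebra: the minimum over all linear forms `f` of the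
dimension of the kernel of the Kirillov form of `f`. The infimum is that of a nonempty set of
natural numbers, so it is attained. -/
def lieIndex (K L : Type*) [Field K] [LieRing L] [LieAlgebra K L] : ℕ :=
  ⨅ f : Module.Dual K L, Module.finrank K (LinearMap.ker (kirillovForm f))

namespace Seaweed

/-- `V_i = span {e_1, …, e_{a_1 + ⋯ + a_i}}` in `K ^ n` (with 0-based indices in the code). For
`i` at least the number of parts of `a` this is the whole space. -/
def topFlag (K : Type*) [Field K] {n : ℕ} (a : Composition n) (i : ℕ) :
    Submodule K (Fin n → K) :=
  Submodule.span K {v | ∃ k : Fin n, (k : ℕ) < a.sizeUpTo i ∧ v = Pi.single k 1}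

/-- `W_j = span {e_{b_1 + ⋯ + b_j + 1}, …, e_n}` in `K ^ n` (with 0-based indices in the code). For
`j` at least the number of parts of `b` this is the zero space. -/
def bottomFlag (K : Type*) [Field K] {n : ℕ} (b : Composition n) (j : ℕ) :
    Submodule K (Fin n → K) :=
  Submodule.span K {v | ∃ k : Fin n, b.sizeUpTo j ≤ (k : ℕ) ∧ v = Pi.single k 1}

/-- The seaweed Lie algebra with top composition `a` and bottom composition `b`: the traceless
matrices that preserve every member of the two flags given by `a` and `b`. -/
def seaweed (K : Type*) [Field K] {n : ℕ} (a b : Composition n) :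
    LieSubalgebra K (LieAlgebra.SpecialLinear.sl (Fin n) K) where
  carrier := {x | (∀ i, ∀ v ∈ topFlag K a i, x.1.mulVec v ∈ topFlag K a i) ∧
    (∀ j, ∀ w ∈ bottomFlag K b j, x.1.mulVec w ∈ bottomFlag K b j)}
  zero_mem' := by
    constructor <;> intro i v _ <;> simp
  add_mem' := by
    intro x y hx hy
    constructor <;> intro i v hv
    · simpa [Matrix.add_mulVec] using add_mem (hx.1 i v hv) (hy.1 i v hv)
    · simpa [Matrix.add_mulVec] using add_mem (hx.2 i v hv) (hy.2 i v hv)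
  smul_mem' := by
    intro c x hx
    constructor <;> intro i v hv
    · simpa [Matrix.smul_mulVec] using Submodule.smul_mem _ c (hx.1 i v hv)
    · simpa [Matrix.smul_mulVec] using Submodule.smul_mem _ c (hx.2 i v hv)
  lie_mem' := by
    intro x y hx hy
    constructor <;> intro i v hv
    · rw [LieAlgebra.SpecialLinear.sl_bracket, Matrix.sub_mulVec, ← Matrix.mulVec_mulVec,
        ← Matrix.mulVec_mulVec]
      exact sub_mem (hx.1 i _ (hy.1 i v hv)) (hy.1 i _ (hx.1 i v hv))
    · rw [LieAlgebra.SpecialLinear.sl_bracket, Matrix.sub_mulVec, ← Matrix.mulVec_mulVec,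
        ← Matrix.mulVec_mulVec]
      exact sub_mem (hx.2 i _ (hy.2 i v hv)) (hy.2 i _ (hx.2 i v hv))

/-- `C(n, k)`: the number of ordered pairs of compositions of `n` whose seaweed subalgebra of
`sl(n)` over `K` has index `k`. -/
def numPairs (K : Type*) [Field K] (n k : ℕ) : ℕ :=
  Nat.card {p : Composition n × Composition n // lieIndex K (seaweed K p.1 p.2) = k}

end Seaweed

end

/-!
A seaweed together with the scalar matrices is the space of all matrices supported on the relation
`α i ≤ α j ∧ β j ≤ β i`, where `α` and `β` number the blocks of the two compositions. Passing to this
algebra raises every stabilizer by the scalar matrices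
(`finrank_radical_eq_finrank_ker_add_one`), so the claim becomes that its index is `n` if the blocks
agree and less than `n` otherwise.

The upper bounds rest on Vinberg's inequality (`exists_finrank_radical_add_smul_le`): the index is at
most the index of the stabilizer of any linear form. It allows an induction on the number of
indices, which follows Panyushev's reduction. If the first blocks of `α` and `β` agree, the form
`x ↦ x a a` at the first index `a` splits off a one-dimensional factor
(`exists_finrank_radical_le_of_isolated`). If one is properly contained in the other, a form that
joins the smaller block to the end of the rest of the larger one has as its stabilizer a seaweed
with fewer indices (`exists_finrank_radical_le_of_arcs`), so that the index drops strictly below the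
number of indices (`exists_finrank_radical_blockRel_le`).

If the blocks agree, the algebra is block diagonal and a linear form is given by a block diagonal
matrix, whose centralizer is the stabilizer. Generically the powers of this matrix are linearly
independent, and by semicontinuity every stabilizer has dimension at least `n`
(`le_finrank_radical_of_equivalence`).

The pairs of index `n - 1` are therefore those on the diagonal, one for each of the `2 ^ (n - 1)`
compositions.
-/

noncomputable section

namespace Seaweed

/-! ### Generic kernels -/

section LinearAlgebra

variable {K : Type*} [Field K]

/-- Upper semicontinuity of the dimension of the kernel along a line. -/
theorem finite_setOf_finrank_ker_lt {V W : Type*} [AddCommGroup V] [Module K V]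
    [FiniteDimensional K V] [AddCommGroup W] [Module K W] (C₀ C₁ : V →ₗ[K] W) :
    {t : K | Module.finrank K (LinearMap.ker C₀) <
      Module.finrank K (LinearMap.ker (C₀ + t • C₁))}.Finite := by
  obtain ⟨U, hU⟩ := Submodule.exists_isCompl (LinearMap.ker C₀)
  have hinj : LinearMap.ker (C₀ ∘ₗ U.subtype) = ⊥ := by
    rw [LinearMap.ker_eq_bot']
    intro u hu
    have : (u : V) ∈ LinearMap.ker C₀ ⊓ U := ⟨hu, u.2⟩
    rw [hU.inf_eq_bot] at this
    exact Subtype.ext this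
  obtain ⟨G, hG⟩ := LinearMap.exists_leftInverse_of_injective _ hinj
  set M : Module.End K U := G ∘ₗ C₁ ∘ₗ U.subtype with hM
  -- away from finitely many `t`, the operator `1 + t M` is injective on `U`
  refine ((Module.End.finite_hasEigenvalue M).image fun μ => -μ⁻¹).subset fun t ht => ?_
  by_contra hne
  rw [Set.mem_ofPred_eq] at ht
  refine absurd ht (not_lt.2 ?_)
  have hdisj : Disjoint (LinearMap.ker (C₀ + t • C₁)) U := by
    rw [Submodule.disjoint_def]
    intro x hx hxU
    have h1 : C₀ x + t • C₁ x = 0 := by simpa using hx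
    set u : U := ⟨x, hxU⟩
    have h2 : u + t • M u = 0 := by
      have h3 : G (C₀ x + t • C₁ x) = 0 := by rw [h1, map_zero]
      have h4 : G (C₀ x) = u := LinearMap.congr_fun hG u
      simpa [h4, hM] using h3
    by_cases ht0 : t = 0
    · rw [ht0, zero_smul, add_zero] at h2
      exact congrArg Subtype.val h2
    by_contra hx0
    refine hne ⟨-t⁻¹, ?_, by simp⟩
    refine Module.End.hasEigenvalue_of_hasEigenvector (x := u)
      (Module.End.hasEigenvector_iff.2 ⟨Module.End.mem_eigenspace_iff.2 ?_, ?_⟩)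
    · have h5 : t • M u = -u := by
        rw [eq_neg_iff_add_eq_zero, add_comm]; exact h2
      calc M u = t⁻¹ • t • M u := by rw [smul_smul, inv_mul_cancel₀ ht0, one_smul]
        _ = -t⁻¹ • u := by rw [h5, smul_neg, neg_smul]
    · exact fun h => hx0 (congrArg Subtype.val h)
  have h1 := Submodule.finrank_add_finrank_le_of_disjoint hdisj
  have h2 := Submodule.finrank_add_eq_of_isCompl hU
  omega

end LinearAlgebra

/-! ### Radicals of commutator forms and Vinberg's inequality -/

section Radical

variable {K A : Type*} [Field K] [Ring A] [Algebra K A]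

/-- The bilinear form `(x, y) ↦ f (x y - y x)` on an associative algebra. -/
def commForm (f : A →ₗ[K] K) : A →ₗ[K] A →ₗ[K] K :=
  LinearMap.mk₂ K (fun x y => f (x * y - y * x))
    (fun x₁ x₂ y => by rw [← map_add]; congr 1; noncomm_ring)
    (fun c x y => by simp [mul_sub])
    (fun x y₁ y₂ => by rw [← map_add]; congr 1; noncomm_ring)
    (fun c x y => by simp [mul_sub])

@[simp] theorem commForm_apply (f : A →ₗ[K] K) (x y : A) :
    commForm f x y = f (x * y - y * x) := rfl

theorem commForm_swap (f : A →ₗ[K] K) (x y : A) : commForm f x y = -commForm f y x := by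
  rw [commForm_apply, commForm_apply, ← map_neg, neg_sub]

/-- The radical of the restriction of `commForm f` to the subspace `S`. -/
def radical (S : Submodule K A) (f : A →ₗ[K] K) : Submodule K A where
  carrier := {x | x ∈ S ∧ ∀ y ∈ S, commForm f x y = 0}
  zero_mem' := ⟨S.zero_mem, fun y _ => by simp⟩
  add_mem' := fun hx hy => ⟨S.add_mem hx.1 hy.1, fun z hz => by
    rw [map_add, LinearMap.add_apply, hx.2 z hz, hy.2 z hz, add_zero]⟩
  smul_mem' := fun c x hx => ⟨S.smul_mem c hx.1, fun z hz => by
    rw [map_smul, LinearMap.smul_apply, hx.2 z hz, smul_zero]⟩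

theorem mem_radical {S : Submodule K A} {f : A →ₗ[K] K} {x : A} :
    x ∈ radical S f ↔ x ∈ S ∧ ∀ y ∈ S, f (x * y - y * x) = 0 := Iff.rfl

variable [FiniteDimensional K A]

theorem finite_setOf_finrank_radical_lt (S : Submodule K A) (f g : A →ₗ[K] K) :
    {t : K | Module.finrank K (radical S f) <
      Module.finrank K (radical S (f + t • g))}.Finite := by
  have key : ∀ h : A →ₗ[K] K, Module.finrank K (radical S h) =
      Module.finrank K (LinearMap.ker ((commForm h).domRestrict₁₂ S S)) := by
    intro h
    have : radical S h = (LinearMap.ker ((commForm h).domRestrict₁₂ S S)).map S.subtype := by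
      ext x
      simp only [mem_radical, Submodule.mem_map, LinearMap.mem_ker, Submodule.subtype_apply,
        Subtype.exists, exists_and_right, exists_eq_right, LinearMap.ext_iff,
        LinearMap.domRestrict₁₂_apply, LinearMap.zero_apply, commForm_apply, Subtype.forall]
      tauto
    rw [this, Submodule.finrank_map_subtype_eq]
  refine (finite_setOf_finrank_ker_lt ((commForm f).domRestrict₁₂ S S)
    ((commForm g).domRestrict₁₂ S S)).subset fun t ht => ?_
  rw [Set.mem_ofPred_eq, key, key] at ht
  have : (commForm (f + t • g)).domRestrict₁₂ S S =
      (commForm f).domRestrict₁₂ S S + t • (commForm g).domRestrict₁₂ S S := by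
    refine LinearMap.ext fun x => LinearMap.ext fun y => ?_
    rfl
  rw [this] at ht
  exact ht

/-- Vinberg's inequality: the index of a Lie algebra is at most the index of the stabilizer
`radical S f` of any linear form `f`. -/
theorem exists_finrank_radical_add_smul_le [Infinite K] (S : Submodule K A) (f g : A →ₗ[K] K) :
    ∃ t : K, Module.finrank K (radical S (f + t • g)) ≤
      Module.finrank K (radical (radical S f) g) := by
  set N := radical S f with hN
  -- For `t ≠ 0` the second component is redundant, since `N` is orthogonal to `S` for `f`.
  set C₀ : S →ₗ[K] (S →ₗ[K] K) × (N →ₗ[K] K) :=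
    ((commForm f).domRestrict₁₂ S S).prod ((commForm g).domRestrict₁₂ S N) with hC₀
  set C₁ : S →ₗ[K] (S →ₗ[K] K) × (N →ₗ[K] K) :=
    ((commForm g).domRestrict₁₂ S S).prod 0 with hC₁
  obtain ⟨t, ht⟩ := ((finite_setOf_finrank_ker_lt C₀ C₁).union
    (Set.finite_singleton (0 : K))).exists_notMem
  simp only [Set.mem_union, Set.mem_ofPred_eq, Set.mem_singleton_iff, not_or, not_lt] at ht
  refine ⟨t, ?_⟩
  have h0 : radical N g = (LinearMap.ker C₀).map S.subtype := by
    ext x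
    simp only [mem_radical, hN, hC₀, Submodule.mem_map, LinearMap.mem_ker, Submodule.subtype_apply,
      Subtype.exists, exists_and_right, exists_eq_right, LinearMap.prod_apply, Function.prod_apply,
      Prod.mk_eq_zero, LinearMap.ext_iff, LinearMap.domRestrict₁₂_apply, LinearMap.zero_apply,
      commForm_apply, Subtype.forall]
    tauto
  have h1 : radical S (f + t • g) ≤ (LinearMap.ker (C₀ + t • C₁)).map S.subtype := by
    rintro x ⟨hxS, hx⟩
    refine ⟨⟨x, hxS⟩, ?_, rfl⟩
    have hx' : ∀ y ∈ S, commForm f x y + t * commForm g x y = 0 := fun y hy => by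
      simpa using hx y hy
    refine Prod.ext (LinearMap.ext fun y => ?_) (LinearMap.ext fun y => ?_)
    · simpa [hC₀, hC₁, LinearMap.domRestrict₁₂_apply] using hx' y y.2
    · have hy : (y : A) ∈ radical S f := y.2
      have h2 := hx' y hy.1
      rw [commForm_swap f, show commForm f y x = 0 from hy.2 x hxS, neg_zero, zero_add,
        mul_eq_zero] at h2
      simpa [hC₀, hC₁, LinearMap.domRestrict₁₂_apply] using h2.resolve_left ht.2
  calc Module.finrank K (radical S (f + t • g))
      ≤ Module.finrank K ((LinearMap.ker (C₀ + t • C₁)).map S.subtype) :=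
        Submodule.finrank_mono h1
    _ = Module.finrank K (LinearMap.ker (C₀ + t • C₁)) := Submodule.finrank_map_subtype_eq _ _
    _ ≤ Module.finrank K (LinearMap.ker C₀) := ht.1
    _ = Module.finrank K (radical N g) := by rw [h0, Submodule.finrank_map_subtype_eq]

/-- Reduction of the index of `S` to that of an algebra `S'` which is a quotient, via `π`, of the
stabilizer of a linear form on `S`; the kernel of the quotient map is added to the bound. -/
theorem exists_finrank_radical_le [Infinite K] {A' : Type*} [Ring A'] [Algebra K A']
    [FiniteDimensional K A'] (S : Submodule K A) (f : A →ₗ[K] K) (S' : Submodule K A')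
    (π : A →ₗ[K] A') (hle : S' ≤ (radical S f).map π)
    (hhom : ∀ x ∈ radical S f, ∀ y ∈ radical S f, π (x * y) = π x * π y)
    (hmem : ∀ x ∈ radical S f, π x ∈ S')
    (f' : A' →ₗ[K] K) :
    ∃ g : A →ₗ[K] K, Module.finrank K (radical S g) ≤
      Module.finrank K (radical S' f') +
        Module.finrank K (radical S f ⊓ LinearMap.ker π : Submodule K A) := by
  obtain ⟨t, ht⟩ := exists_finrank_radical_add_smul_le S f (f' ∘ₗ π)
  refine ⟨_, ht.trans ?_⟩
  set N := radical S f
  set Q := radical N (f' ∘ₗ π)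
  have h1 := LinearMap.finrank_range_add_finrank_ker (π.domRestrict Q)
  have h2 : LinearMap.range (π.domRestrict Q) ≤ radical S' f' := by
    rintro _ ⟨⟨x, hx⟩, rfl⟩
    refine mem_radical.2 ⟨hmem x hx.1, fun y' hy' => ?_⟩
    obtain ⟨y, hy, rfl⟩ := hle hy'
    have := hx.2 y hy
    rw [commForm_apply, LinearMap.comp_apply, map_sub, hhom x hx.1 y hy, hhom y hy x hx.1] at this
    exact this
  have h3 : (LinearMap.ker (π.domRestrict Q)).map Q.subtype ≤ N ⊓ LinearMap.ker π := by
    rintro _ ⟨⟨x, hx⟩, hx', rfl⟩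
    exact ⟨hx.1, hx'⟩
  have h4 := Submodule.finrank_mono h2
  have h5 := Submodule.finrank_mono h3
  rw [Submodule.finrank_map_subtype_eq] at h5
  omega

end Radical

/-! ### Reductions for incidence matrices of a relation -/

section Incidence

open Matrix

variable {K : Type*} [Field K] {ι : Type*}

/-- The matrices supported on the relation `r`. For a preorder this is its incidence algebra. -/
def incidence (K : Type*) [Field K] {ι : Type*} (r : ι → ι → Prop) :
    Submodule K (Matrix ι ι K) where
  carrier := {x | ∀ i j, ¬ r i j → x i j = 0}
  zero_mem' := fun _ _ _ => rfl
  add_mem' := fun hx hy i j h => by rw [Matrix.add_apply, hx i j h, hy i j h, add_zero]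
  smul_mem' := fun c x hx i j h => by rw [Matrix.smul_apply, hx i j h, smul_zero]

theorem mem_incidence {r : ι → ι → Prop} {x : Matrix ι ι K} :
    x ∈ incidence K r ↔ ∀ i j, ¬ r i j → x i j = 0 := Iff.rfl

theorem single_mem_incidence [DecidableEq ι] {r : ι → ι → Prop} {i j : ι} (h : r i j) (c : K) :
    Matrix.single i j c ∈ incidence K r := by
  intro p q hpq
  refine Matrix.single_apply_of_ne _ _ _ _ _ ?_
  rintro ⟨rfl, rfl⟩
  exact hpq h

theorem mul_mem_incidence [Fintype ι] {r : ι → ι → Prop} (htrans : ∀ i j k, r i j → r j k → r i k)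
    {x y : Matrix ι ι K} (hx : x ∈ incidence K r) (hy : y ∈ incidence K r) :
    x * y ∈ incidence K r := by
  intro i j hij
  rw [Matrix.mul_apply]
  refine Finset.sum_eq_zero fun k _ => ?_
  by_cases h : r i k
  · rw [hy k j fun h' => hij (htrans i k j h h'), mul_zero]
  · rw [hx i k h, zero_mul]

/-- The linear form `x ↦ ∑ i ∈ s, x i (τ i)`. -/
def arcForm (K : Type*) [Field K] {ι : Type*} (s : Finset ι) (τ : ι → ι) : Matrix ι ι K →ₗ[K] K :=
  ∑ i ∈ s, Matrix.entryLinearMap K K i (τ i)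

theorem arcForm_apply (s : Finset ι) (τ : ι → ι) (x : Matrix ι ι K) :
    arcForm K s τ x = ∑ i ∈ s, x i (τ i) := by
  simp [arcForm, LinearMap.sum_apply]

variable [Fintype ι] [DecidableEq ι]

theorem arcForm_bracket_single (s : Finset ι) (τ : ι → ι) (x : Matrix ι ι K) (p q : ι) :
    arcForm K s τ (x * Matrix.single p q 1 - Matrix.single p q 1 * x) =
      (∑ i ∈ s, if q = τ i then x i p else 0) - if p ∈ s then x q (τ p) else 0 := by
  simp only [arcForm_apply, Matrix.sub_apply, Finset.sum_sub_distrib]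
  congr 1
  · refine Finset.sum_congr rfl fun i _ => ?_
    split_ifs with h
    · rw [h, Matrix.mul_single_apply_same, mul_one]
    · exact Matrix.mul_single_apply_of_ne _ _ _ _ _ (Ne.symm h) _
  · rw [← Finset.sum_ite_eq s p fun i => x q (τ i)]
    refine Finset.sum_congr rfl fun i _ => ?_
    split_ifs with h
    · rw [← h, Matrix.single_mul_apply_same, one_mul]
    · exact Matrix.single_mul_apply_of_ne _ _ _ _ _ (Ne.symm h) _

/-- If the relations of `r` at `a` are symmetric, the stabilizer of the linear form `x ↦ x a a` is
the direct product of the incidence matrices of `r` away from `a` and of those at `a`, the multiples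
of `single a a 1`. -/
theorem exists_finrank_radical_le_of_isolated [Infinite K] (r : ι → ι → Prop) (a : ι)
    (hsymm : ∀ i, r a i ↔ r i a)
    (f' : Matrix {i // i ≠ a} {i // i ≠ a} K →ₗ[K] K) :
    ∃ g : Matrix ι ι K →ₗ[K] K, Module.finrank K (radical (incidence K r) g) ≤
      Module.finrank K (radical (incidence K fun i j : {i // i ≠ a} => r i j) f') + 1 := by
  set S := incidence K r with hS
  set S' := incidence K fun i j : {i // i ≠ a} => r i j with hS'
  set f := arcForm K {a} id with hf
  -- the elements of the stabilizer have no off-diagonal entries in the row and column of `a`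
  have hker : ∀ x ∈ radical S f, ∀ i, i ≠ a → x a i = 0 ∧ x i a = 0 := by
    rintro x ⟨hxS, hx⟩ i hi
    constructor
    · by_cases h : r a i
      · have := hx _ (single_mem_incidence ((hsymm i).1 h) 1)
        rw [commForm_apply, hf, arcForm_bracket_single] at this
        simpa [hi] using this
      · exact hxS _ _ h
    · by_cases h : r i a
      · have := hx _ (single_mem_incidence ((hsymm i).2 h) 1)
        rw [commForm_apply, hf, arcForm_bracket_single] at this
        simpa [hi] using this
      · exact hxS _ _ h
  set π : Matrix ι ι K →ₗ[K] Matrix {i // i ≠ a} {i // i ≠ a} K :=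
    { toFun := fun x => x.submatrix Subtype.val Subtype.val
      map_add' := fun _ _ => rfl
      map_smul' := fun _ _ => rfl } with hπ
  have hπ' : ∀ x i j, π x i j = x i j := fun _ _ _ => rfl
  have hle : S' ≤ (radical S f).map π := by
    intro y hy
    set x : Matrix ι ι K := Matrix.of fun i j =>
      if h : i ≠ a ∧ j ≠ a then y ⟨i, h.1⟩ ⟨j, h.2⟩ else 0 with hx
    have hxa : ∀ i, x a i = 0 := fun i => by simp [hx]
    have hxa' : ∀ i, x i a = 0 := fun i => by simp [hx]
    refine ⟨x, ⟨?_, ?_⟩, ?_⟩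
    · intro i j hij
      by_cases h : i ≠ a ∧ j ≠ a
      · rw [hx, Matrix.of_apply, dif_pos h]
        exact hy _ _ hij
      · rw [hx, Matrix.of_apply, dif_neg h]
    · intro z _
      rw [commForm_apply, hf, arcForm_apply]
      simp [Matrix.mul_apply, hxa, hxa']
    · ext i j
      rw [hπ', hx, Matrix.of_apply, dif_pos ⟨i.2, j.2⟩]
  have hhom : ∀ x ∈ radical S f, ∀ y ∈ radical S f, π (x * y) = π x * π y := by
    intro x hx y hy
    ext i j
    rw [hπ', Matrix.mul_apply, Matrix.mul_apply, ← Fintype.sum_subtype_add_sum_subtype (· ≠ a)]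
    simp only [hπ']
    rw [add_eq_left]
    refine Finset.sum_eq_zero fun k _ => ?_
    rw [not_not.1 k.2, (hker x hx i i.2).2, zero_mul]
  have hmem : ∀ x ∈ radical S f, π x ∈ S' := by
    intro x hx i j hij
    exact hx.1 _ _ hij
  obtain ⟨g, hg⟩ := exists_finrank_radical_le S f S' π hle hhom hmem f'
  refine ⟨g, hg.trans (Nat.add_le_add_left ?_ _)⟩
  have hle : radical S f ⊓ LinearMap.ker π ≤ K ∙ (Matrix.single a a (1 : K)) := by
    rintro x ⟨hx, hx'⟩
    refine Submodule.mem_span_singleton.2 ⟨x a a, ?_⟩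
    ext i j
    rw [Matrix.smul_apply, Matrix.single_apply]
    by_cases hi : i = a
    · by_cases hj : j = a
      · simp [hi, hj]
      · simp [hi, Ne.symm hj, (hker x hx j hj).1]
    · by_cases hj : j = a
      · simp [Ne.symm hi, hj, (hker x hx i hi).2]
      · have : π x ⟨i, hi⟩ ⟨j, hj⟩ = 0 := by rw [LinearMap.mem_ker.1 hx']; rfl
        rw [hπ'] at this
        simp [Ne.symm hi, this]
  exact (Submodule.finrank_mono hle).trans (finrank_span_le_card _ |>.trans (by simp))

/-- Reduction along arcs. `A` is an upper-row block whose rows reach exactly `A ∪ B`, and `τ` matches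
the subset `A₂` of `A` with the subset `B₂` of `B`, exhausting `A` or `B`. The stabilizer of the
form `∑ i ∈ A₂, x i (τ i)` acts on `A₂` and on `B₂` in the same way. Identifying `A₂` with `B₂`
embeds it in the matrices indexed by the complement of `A₂`, with image the incidence matrices of
the relation that `r` induces, less the pairs from `B \ B₂` to `B₂`. -/
theorem exists_finrank_radical_le_of_arcs [Infinite K] (r : ι → ι → Prop) (A A₂ B B₂ : Finset ι)
    (hA : A₂ ⊆ A) (hB : B₂ ⊆ B) (hAB : Disjoint A B) (hfull : A ⊆ A₂ ∨ B ⊆ B₂)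
    (hrA : ∀ i ∈ A, ∀ j, r i j ↔ j ∈ A ∨ j ∈ B)
    (hrA' : ∀ i j, j ∈ A → r i j → i ∈ A)
    (hrB : ∀ i ∈ B, ∀ j, r i j → j ∈ B)
    (hrB₂ : ∀ i ∈ B, i ∉ B₂ → ∀ j ∈ B₂, r i j)
    (τ : ι → ι) (hτA : ∀ i ∈ A₂, τ i ∈ B₂ ∧ τ (τ i) = i) (hτB : ∀ i ∈ B₂, τ i ∈ A₂ ∧ τ (τ i) = i)
    (f' : Matrix {i // i ∉ A₂} {i // i ∉ A₂} K →ₗ[K] K) :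
    ∃ g : Matrix ι ι K →ₗ[K] K, Module.finrank K (radical (incidence K r) g) ≤
      Module.finrank K (radical (incidence K fun i j : {i // i ∉ A₂} =>
        r i j ∧ ¬ ((i : ι) ∈ B ∧ (i : ι) ∉ B₂ ∧ (j : ι) ∈ B₂)) f') := by
  set S := incidence K r with hS
  set S' := incidence K fun i j : {i // i ∉ A₂} =>
    r i j ∧ ¬ ((i : ι) ∈ B ∧ (i : ι) ∉ B₂ ∧ (j : ι) ∈ B₂) with hS'
  set f := arcForm K A₂ τ with hf
  have hnAB : ∀ i ∈ A, i ∉ B := fun i hi hi' => Finset.disjoint_left.1 hAB hi hi'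
  have hnBA : ∀ i ∈ B, i ∉ A := fun i hi hi' => Finset.disjoint_left.1 hAB hi' hi
  -- Testing an element of the stabilizer against `single p q 1` compares two of its entries. The
  -- facts `hd`, `hb`, `hc`, `ha` below describe the stabilizer block by block.
  have hkey : ∀ x ∈ radical S f, ∀ p q, r p q →
      (if q ∈ B₂ then x (τ q) p else 0) = if p ∈ A₂ then x q (τ p) else 0 := by
    rintro x ⟨hxS, hx⟩ p q hpq
    have := hx _ (single_mem_incidence hpq 1)
    rw [commForm_apply, hf, arcForm_bracket_single, sub_eq_zero] at this
    rw [← this]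
    split_ifs with hq
    · rw [Finset.sum_eq_single (τ q)]
      · rw [(hτB q hq).2, if_pos rfl]
      · intro i hi hne
        refine if_neg fun h => hne ?_
        rw [h, (hτA i hi).2]
      · exact fun h => absurd (hτB q hq).1 h
    · symm
      refine Finset.sum_eq_zero fun i hi => if_neg ?_
      rintro rfl
      exact hq (hτA i hi).1
  have hd : ∀ x ∈ S, ∀ i ∉ A, ∀ j ∈ A, x i j = 0 := fun x hx i hi j hj =>
    hx i j fun h => hi (hrA' i j hj h)
  have hb : ∀ x ∈ radical S f, ∀ i, (i ∈ A ∨ i ∈ B) → i ∉ B₂ → ∀ j ∈ B₂, x i j = 0 := by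
    intro x hx i hi hi₂ j hj
    have := hkey x hx (τ j) i ((hrA _ (hA (hτB j hj).1) _).2 hi)
    rw [if_neg hi₂, if_pos (hτB j hj).1, (hτB j hj).2] at this
    exact this.symm
  have hc : ∀ x ∈ radical S f, ∀ i ∈ A₂, ∀ j ∈ A₂, x i j = x (τ i) (τ j) := by
    intro x hx i hi j hj
    have := hkey x hx j (τ i) ((hrA _ (hA hj) _).2 (Or.inr (hB (hτA i hi).1)))
    rw [if_pos (hτA i hi).1, if_pos hj, (hτA i hi).2] at this
    exact this
  have ha : ∀ x ∈ radical S f, ∀ i ∈ A₂, ∀ j ∉ A₂, x i j = 0 := by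
    intro x hx i hi j hj
    by_cases hjB₂ : j ∈ B₂
    · exact hb x hx i (Or.inl (hA hi)) (fun h => hnAB i (hA hi) (hB h)) j hjB₂
    by_cases hr : r j (τ i)
    · have := hkey x hx j (τ i) hr
      rwa [if_pos (hτA i hi).1, if_neg hj, (hτA i hi).2] at this
    · refine hx.1 i j fun hij => hr ?_
      rcases (hrA i (hA hi) j).1 hij with h | h
      · exact (hrA j h _).2 (Or.inr (hB (hτA i hi).1))
      · exact hrB₂ j h hjB₂ _ (hτA i hi).1
  -- Since `x i j` and `x i (τ j)` are never both nonzero in the stabilizer, adding them amounts to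
  -- moving the columns of `A₂` to those of `B₂`.
  set π : Matrix ι ι K →ₗ[K] Matrix {i // i ∉ A₂} {i // i ∉ A₂} K :=
    { toFun := fun x => Matrix.of fun i j => x i j + if (j : ι) ∈ B₂ then x i (τ j) else 0
      map_add' := fun x y => by
        ext i j
        simp only [Matrix.of_apply, Matrix.add_apply]
        split_ifs <;> ring
      map_smul' := fun c x => by
        ext i j
        simp only [Matrix.of_apply, Matrix.smul_apply, RingHom.id_apply, smul_eq_mul]
        split_ifs <;> ring } with hπ
  have hπ' : ∀ x i j, π x i j = x i j + if (j : ι) ∈ B₂ then x i (τ j) else 0 :=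
    fun _ _ _ => rfl
  have hB₂A₂ : ∀ i ∈ B₂, i ∉ A₂ := fun i hi hi' => hnBA i (hB hi) (hA hi')
  have hle : S' ≤ (radical S f).map π := by
    intro y hy
    -- `y'` is `y` extended by zero, and `x` is the preimage of `y` in the stabilizer
    set y' : ι → ι → K := fun i j =>
      if h : i ∉ A₂ ∧ j ∉ A₂ then y ⟨i, h.1⟩ ⟨j, h.2⟩ else 0 with hy'
    have hyy : ∀ i j : {i // i ∉ A₂}, y' i j = y i j := fun i j => by
      simp only [hy', dif_pos (And.intro i.2 j.2)]
    have hyr : ∀ i j, ¬ r i j → y' i j = 0 := by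
      intro i j hij
      simp only [hy']
      split_ifs with h
      · exact hy _ _ fun h' => hij h'.1
      · rfl
    have hyB : ∀ i ∈ B, i ∉ B₂ → ∀ j ∈ B₂, y' i j = 0 := by
      intro i hi hi₂ j hj
      simp only [hy']
      split_ifs with h
      · exact hy _ _ fun h' => h'.2 ⟨hi, hi₂, hj⟩
      · rfl
    set x : Matrix ι ι K := Matrix.of fun i j =>
      if i ∈ A₂ then (if j ∈ A₂ then y' (τ i) (τ j) else 0)
      else if j ∈ A₂ then (if i ∈ A then y' i (τ j) else 0)
      else if i ∈ A ∧ j ∈ B₂ then 0 else y' i j with hx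
    have hx' : ∀ i j, x i j = if i ∈ A₂ then (if j ∈ A₂ then y' (τ i) (τ j) else 0)
      else if j ∈ A₂ then (if i ∈ A then y' i (τ j) else 0)
      else if i ∈ A ∧ j ∈ B₂ then 0 else y' i j := fun _ _ => rfl
    refine ⟨x, ⟨?_, ?_⟩, ?_⟩
    · intro i j hij
      rw [hx']
      split_ifs with h1 h2 h3 h4 h5
      · exact absurd ((hrA i (hA h1) j).2 (Or.inl (hA h2))) hij
      · rfl
      · exact absurd ((hrA i h4 j).2 (Or.inl (hA h3))) hij
      · rfl
      · rfl
      · exact hyr i j hij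
    · intro z hz
      rw [commForm_apply, map_sub, sub_eq_zero, hf, arcForm_apply, arcForm_apply]
      have e1 : ∀ i ∈ A₂, (x * z) i (τ i) = ∑ k ∈ A₂, y' (τ i) (τ k) * z k (τ i) := by
        intro i hi
        rw [Matrix.mul_apply, ← Finset.sum_subset (Finset.subset_univ A₂)]
        · refine Finset.sum_congr rfl fun k hk => ?_
          rw [hx', if_pos hi, if_pos hk]
        · intro k _ hk
          rw [hx', if_pos hi, if_neg hk, zero_mul]
      have e2 : ∀ i ∈ A₂, (z * x) i (τ i) = ∑ k ∈ A₂, z i (τ k) * y' (τ k) (τ i) := by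
        intro i hi
        have hτi := hB₂A₂ _ (hτA i hi).1
        rw [Matrix.mul_apply, ← Finset.sum_subset (Finset.subset_univ B₂)]
        · refine Finset.sum_bij' (fun k _ => τ k) (fun k _ => τ k) (fun k hk => (hτB k hk).1)
            (fun k hk => (hτA k hk).1) (fun k hk => (hτB k hk).2) (fun k hk => (hτA k hk).2) ?_
          intro k hk
          rw [hx', if_neg (hB₂A₂ k hk), if_neg hτi, if_neg fun h => hnBA k (hB hk) h.1,
            (hτB k hk).2]
        · intro k _ hk
          by_cases hik : r i k
          · rw [hx', if_neg hτi, if_neg hτi]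
            rcases (hrA i (hA hi) k).1 hik with h | h
            · simp [h, (hτA i hi).1]
            · rw [if_neg fun h' => hnBA k h (hA h'), if_neg fun h' => hnBA k h h'.1,
                hyB k h hk _ (hτA i hi).1, mul_zero]
          · rw [hz i k hik, zero_mul]
      rw [Finset.sum_congr rfl e1, Finset.sum_congr rfl e2, Finset.sum_comm]
      exact Finset.sum_congr rfl fun i _ => Finset.sum_congr rfl fun k _ => mul_comm _ _
    · ext i j
      rw [hπ', hx', hx', if_neg i.2, if_neg i.2, if_neg j.2, ← hyy]
      by_cases hj : (j : ι) ∈ B₂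
      · rw [if_pos hj, if_pos (hτB j hj).1, (hτB j hj).2]
        by_cases hi : (i : ι) ∈ A
        · simp [hi, hj]
        · simp [hi]
      · simp [hj]
  have hhom : ∀ x ∈ radical S f, ∀ y ∈ radical S f, π (x * y) = π x * π y := by
    intro x hx y hy
    ext i j
    set c : ι → K := fun k => y k j + if (j : ι) ∈ B₂ then y k (τ j) else 0 with hcdef
    have e1 : π (x * y) i j = ∑ k, x i k * c k := by
      rw [hπ', Matrix.mul_apply, Matrix.mul_apply]
      split_ifs with h
      · rw [← Finset.sum_add_distrib]
        exact Finset.sum_congr rfl fun k _ => by simp only [hcdef, if_pos h]; ring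
      · rw [add_zero]
        exact Finset.sum_congr rfl fun k _ => by simp only [hcdef, if_neg h]; ring
    have e2 : (π x * π y) i j = ∑ k : {k // k ∉ A₂}, x i k * c k +
        ∑ k : {k // k ∉ A₂}, (if (k : ι) ∈ B₂ then x i (τ k) * c k else 0) := by
      rw [Matrix.mul_apply, ← Finset.sum_add_distrib]
      refine Finset.sum_congr rfl fun k _ => ?_
      rw [hπ', hπ', add_mul, ite_mul, zero_mul]
    have e3 : ∑ k : {k // k ∉ A₂}, (if (k : ι) ∈ B₂ then x i (τ k) * c k else 0) =
        ∑ k ∈ B₂, x i (τ k) * c k := by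
      rw [← Finset.sum_subtype_of_mem (p := (· ∉ A₂)) (fun k => x i (τ k) * c k) hB₂A₂,
        ← Finset.sum_filter]
      refine Finset.sum_congr ?_ fun _ _ => rfl
      ext k
      simp
    have e4 : ∑ k ∈ B₂, x i (τ k) * c k = ∑ k ∈ A₂, x i k * c (τ k) := by
      refine Finset.sum_bij' (fun k _ => τ k) (fun k _ => τ k) (fun k hk => (hτB k hk).1)
        (fun k hk => (hτA k hk).1) (fun k hk => (hτB k hk).2) (fun k hk => (hτA k hk).2) ?_
      intro k hk
      rw [(hτB k hk).2]
    -- In the rows `i ∈ A \ A₂` the identity uses `B ⊆ B₂`; the other rows vanish on `A₂`.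
    have e5 : ∑ k ∈ A₂, x i k * c (τ k) = ∑ k ∈ A₂, x i k * c k := by
      refine Finset.sum_congr rfl fun k hk => ?_
      by_cases hi : (i : ι) ∈ A
      · have hBB : B ⊆ B₂ := hfull.resolve_left fun h => i.2 (h hi)
        congr 1
        have hτk := (hτA k hk).1
        have hτkA := hnBA _ (hB hτk)
        simp only [hcdef]
        rw [ha y hy k hk j j.2, zero_add]
        split_ifs with hj
        · rw [hd y hy.1 _ hτkA _ (hA (hτB j hj).1), add_zero, hc y hy k hk _ (hτB j hj).1,
            (hτB j hj).2]
        · rw [add_zero]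
          exact hy.1 _ _ fun h => hj (hBB (hrB _ (hB hτk) _ h))
      · rw [hd x hx.1 i hi k (hA hk), zero_mul, zero_mul]
    rw [e1, e2, e3, e4, e5, ← Fintype.sum_subtype_add_sum_subtype (· ∉ A₂)]
    congr 1
    rw [← Finset.sum_subtype (F := inferInstance) A₂ (p := fun k => ¬ k ∉ A₂) (fun k => by simp)
      fun k => x i k * c k]
  have hmem : ∀ x ∈ radical S f, π x ∈ S' := by
    intro x hx i j hij
    rw [hπ']
    have h1 : (if (j : ι) ∈ B₂ then x i (τ j) else 0) = 0 := by
      split_ifs with hj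
      · by_cases hi : (i : ι) ∈ A
        · exact absurd ⟨(hrA i hi j).2 (Or.inr (hB hj)), fun h => hnAB i hi h.1⟩ hij
        · exact hd x hx.1 i hi _ (hA (hτB j hj).1)
      · rfl
    rw [h1, add_zero]
    by_cases hr : r i j
    · obtain ⟨h2, h3, h4⟩ := not_not.1 fun h => hij ⟨hr, h⟩
      exact hb x hx i (Or.inr h2) h3 j h4
    · exact hx.1 _ _ hr
  obtain ⟨g, hg⟩ := exists_finrank_radical_le S f S' π hle hhom hmem f'
  refine ⟨g, hg.trans (le_of_eq ?_)⟩
  rw [Nat.add_eq_left, Submodule.finrank_eq_zero, Submodule.eq_bot_iff]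
  rintro x ⟨hx, hx'⟩
  have h0 : ∀ i ∉ A₂, ∀ j ∉ A₂, x i j + (if j ∈ B₂ then x i (τ j) else 0) = 0 := by
    intro i hi j hj
    rw [← hπ' x ⟨i, hi⟩ ⟨j, hj⟩, LinearMap.mem_ker.1 hx']
    rfl
  have h1 : ∀ i ∉ A₂, ∀ j ∈ B₂, x i j + x i (τ j) = 0 := fun i hi j hj => by
    have := h0 i hi j (hB₂A₂ j hj)
    rwa [if_pos hj] at this
  have h2 : ∀ i ∉ A₂, ∀ j ∈ B₂, x i j = 0 := by
    intro i hi j hj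
    by_cases hiA : i ∈ A
    · exact hb x hx i (Or.inl hiA) (fun h => hnAB i hiA (hB h)) j hj
    · have := h1 i hi j hj
      rwa [hd x hx.1 i hiA _ (hA (hτB j hj).1), add_zero] at this
  ext i j
  rw [Matrix.zero_apply]
  by_cases hi : i ∈ A₂
  · by_cases hj : j ∈ A₂
    · rw [hc x hx i hi j hj]
      exact h2 _ (hB₂A₂ _ (hτA i hi).1) _ (hτA j hj).1
    · exact ha x hx i hi j hj
  · by_cases hj : j ∈ A₂
    · have := h1 i hi _ (hτA j hj).1
      rwa [h2 i hi _ (hτA j hj).1, zero_add, (hτA j hj).2] at this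
    · by_cases hj₂ : j ∈ B₂
      · exact h2 i hi j hj₂
      · have := h0 i hi j hj
        rwa [if_neg hj₂, add_zero] at this

end Incidence

/-! ### Upper bound for the index -/

section Induction

open Matrix

variable {K : Type*} [Field K]

/-- The support of the matrices in the seaweed whose blocks are the fibres of `α` (for the top
composition) and of `β` (for the bottom composition). -/
def blockRel {ι : Type*} (α β : ι → ℕ) (i j : ι) : Prop := α i ≤ α j ∧ β j ≤ β i

theorem exists_upper_subset_card_eq {ι : Type*} [LinearOrder ι] (s : Finset ι) {k : ℕ}
    (hk : k ≤ s.card) :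
    ∃ t ⊆ s, t.card = k ∧ ∀ i ∈ s, i ∉ t → ∀ j ∈ t, i < j := by
  induction k with
  | zero => exact ⟨∅, by simp, rfl, by simp⟩
  | succ k ih =>
    obtain ⟨t, hts, htk, ht⟩ := ih (by omega)
    have hne : (s \ t).Nonempty := by
      rw [← Finset.card_pos, Finset.card_sdiff_of_subset hts]
      omega
    have hm := Finset.mem_sdiff.1 ((s \ t).max'_mem hne)
    set m := (s \ t).max' hne
    refine ⟨insert m t, Finset.insert_subset hm.1 hts, ?_, ?_⟩
    · rw [Finset.card_insert_of_notMem hm.2, htk]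
    · intro i hi hit j hj
      rw [Finset.mem_insert, not_or] at hit
      rcases Finset.mem_insert.1 hj with rfl | hj
      · exact lt_of_le_of_ne ((s \ t).le_max' i (Finset.mem_sdiff.2 ⟨hi, hit.2⟩)) hit.1
      · exact ht i hi hit.2 j hj

/-- Transposition, an anti-isomorphism, preserves the dimensions of the radicals. -/
theorem finrank_radical_transpose {ι : Type*} [Fintype ι] [DecidableEq ι] (r : ι → ι → Prop)
    (f : Matrix ι ι K →ₗ[K] K) :
    Module.finrank K (radical (incidence K fun i j => r j i)
      (f ∘ₗ (Matrix.transposeLinearEquiv ι ι K K).toLinearMap)) =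
    Module.finrank K (radical (incidence K r) f) := by
  have h : ∀ (x : Matrix ι ι K), xᵀ ∈ incidence K r ↔ x ∈ incidence K fun i j => r j i :=
    fun x => ⟨fun hx i j hij => hx j i hij, fun hx i j hij => hx j i hij⟩
  rw [← LinearEquiv.finrank_map_eq (Matrix.transposeLinearEquiv ι ι K K)
    (radical (incidence K r) f)]
  have : radical (incidence K fun i j => r j i)
      (f ∘ₗ (Matrix.transposeLinearEquiv ι ι K K).toLinearMap) =
      (radical (incidence K r) f).map (Matrix.transposeLinearEquiv ι ι K K).toLinearMap := by
    ext x
    constructor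
    · rintro ⟨hx, hx'⟩
      refine ⟨xᵀ, ⟨(h x).2 hx, fun y hy => ?_⟩, transpose_transpose x⟩
      have h1 := hx' yᵀ ((h yᵀ).1 hy)
      rw [commForm_swap, neg_eq_zero]
      simpa [transpose_sub, transpose_mul] using h1
    · rintro ⟨x, ⟨hx, hx'⟩, rfl⟩
      refine ⟨(h _).1 hx, fun y hy => ?_⟩
      have h1 := hx' yᵀ ((h y).2 hy)
      rw [commForm_swap, neg_eq_zero]
      simpa [transpose_sub, transpose_mul] using h1
  rw [this]

/-- The strict inequality when the first block of `α` is properly contained in the first block of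
`β`. The arcs join the first block `A` of `α` to the last elements of the rest `B` of the first
block of `β`; the reduced algebra is again a seaweed, with strictly fewer indices. -/
theorem exists_finrank_radical_lt_of_subset [Infinite K] {ι : Type*} [Fintype ι] [LinearOrder ι]
    (α β : ι → ℕ) (hα : Monotone α) (hβ : Monotone β)
    (ih : ∀ (s : Finset ι), s.Nonempty → ∀ α β : {i // i ∉ s} → ℕ, Monotone α → Monotone β →
      ∃ f : Matrix {i // i ∉ s} {i // i ∉ s} K →ₗ[K] K,
        Module.finrank K (radical (incidence K (blockRel α β)) f) ≤ Fintype.card {i // i ∉ s})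
    (a : ι) (ha : ∀ i, a ≤ i) (hsub : ∀ i, α i = α a → β i = β a)
    (hne : ∃ b, β b = β a ∧ α b ≠ α a) :
    ∃ f : Matrix ι ι K →ₗ[K] K,
      Module.finrank K (radical (incidence K (blockRel α β)) f) < Fintype.card ι := by
  classical
  set A := Finset.univ.filter fun i => α i = α a with hAdef
  set B := Finset.univ.filter fun i => β i = β a ∧ α i ≠ α a with hBdef
  have memA : ∀ i, i ∈ A ↔ α i = α a := fun i => by simp [hAdef]
  have memB : ∀ i, i ∈ B ↔ β i = β a ∧ α i ≠ α a := fun i => by simp [hBdef]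
  have hαa : ∀ i, α a ≤ α i := fun i => hα (ha i)
  have hβa : ∀ i, β a ≤ β i := fun i => hβ (ha i)
  have hAB : Disjoint A B := Finset.disjoint_left.2 fun i hi hi' =>
    ((memB i).1 hi').2 ((memA i).1 hi)
  have hApos : 0 < A.card := Finset.card_pos.2 ⟨a, (memA a).2 rfl⟩
  have hBpos : 0 < B.card := by
    obtain ⟨b, hb⟩ := hne
    exact Finset.card_pos.2 ⟨b, (memB b).2 hb⟩
  obtain ⟨A₂, hA, hA₂⟩ := Finset.exists_subset_card_eq (min_le_left A.card B.card)
  obtain ⟨B₂, hB, hB₂, hup⟩ := exists_upper_subset_card_eq B (min_le_right A.card B.card)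
  have hfull : A ⊆ A₂ ∨ B ⊆ B₂ := by
    rcases le_total A.card B.card with h | h
    · left
      rw [Finset.eq_of_subset_of_card_le hA (by omega)]
    · right
      rw [Finset.eq_of_subset_of_card_le hB (by omega)]
  let e : A₂ ≃ B₂ := Finset.equivOfCardEq (hA₂.trans hB₂.symm)
  set τ : ι → ι := fun i => if h : i ∈ A₂ then e ⟨i, h⟩ else
    if h : i ∈ B₂ then e.symm ⟨i, h⟩ else i with hτ
  have hdisj : ∀ i ∈ B₂, i ∉ A₂ := fun i hi hi' =>
    Finset.disjoint_left.1 hAB (hA hi') (hB hi)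
  have hτ₁ : ∀ i (h : i ∈ A₂), τ i = e ⟨i, h⟩ := fun i h => by simp only [hτ, dif_pos h]
  have hτ₂ : ∀ i (h : i ∈ B₂), τ i = e.symm ⟨i, h⟩ := fun i h => by
    simp only [hτ, dif_pos h, dif_neg (hdisj i h)]
  have hτA : ∀ i ∈ A₂, τ i ∈ B₂ ∧ τ (τ i) = i := by
    intro i hi
    have h : τ i ∈ B₂ := by rw [hτ₁ i hi]; exact (e _).2
    refine ⟨h, ?_⟩
    rw [hτ₂ _ h]
    simp [hτ₁ i hi]
  have hτB : ∀ i ∈ B₂, τ i ∈ A₂ ∧ τ (τ i) = i := by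
    intro i hi
    have h : τ i ∈ A₂ := by rw [hτ₂ i hi]; exact (e.symm _).2
    refine ⟨h, ?_⟩
    rw [hτ₁ _ h]
    simp [hτ₂ i hi]
  -- `β'` splits the first block of `β` between `B \ B₂` and `B₂`. It places `A \ A₂` together with
  -- `B₂`, which is harmless since one of `A \ A₂` and `B \ B₂` is empty.
  set β' : {i // i ∉ A₂} → ℕ := fun i =>
    if (i : ι) ∈ B ∧ (i : ι) ∉ B₂ then 2 * β i else 2 * β i + 1 with hβ'
  have hrest : ∀ i, i ∉ A₂ → β i = β a → ∀ j ∈ B, j ∉ B₂ → ¬ (i ∈ B ∧ i ∉ B₂) → i ∈ B₂ := by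
    intro i hi hiM j hj hj₂ hi'
    by_cases hiA : i ∈ A
    · rcases hfull with h | h
      · exact absurd (h hiA) hi
      · exact absurd (h hj) hj₂
    · by_contra h
      exact hi' ⟨(memB i).2 ⟨hiM, fun h' => hiA ((memA i).2 h')⟩, h⟩
  have hβ'mono : Monotone β' := by
    intro i j hij
    have h1 := hβ hij
    simp only [hβ']
    split_ifs with h2 h3 h3
    · omega
    · omega
    · have h4 := ((memB j).1 h3.1).1
      have h5 := hβa i
      have h6 := hrest i i.2 (by omega) j h3.1 h3.2 h2
      exact absurd (hup j h3.1 h3.2 i h6) (not_lt.2 hij)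
    · omega
  obtain ⟨f', hf'⟩ := ih A₂ (Finset.card_pos.1 (by omega)) (fun i => α i) β'
    (fun i j hij => hα hij) hβ'mono
  have hrA : ∀ i ∈ A, ∀ j, blockRel α β i j ↔ j ∈ A ∨ j ∈ B := by
    intro i hi j
    have h1 := (memA i).1 hi
    have h2 := hsub i h1
    have h3 := hαa j
    have h4 := hβa j
    have h5 := hsub j
    rw [memA, memB, blockRel]
    omega
  have hrA' : ∀ i j, j ∈ A → blockRel α β i j → i ∈ A := by
    intro i j hj hij
    rw [memA] at hj ⊢
    exact le_antisymm (hj ▸ hij.1) (hαa i)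
  have hrB : ∀ i ∈ B, ∀ j, blockRel α β i j → j ∈ B := by
    intro i hi j hij
    rw [memB] at hi ⊢
    have h3 := hαa i
    have h4 := hβa j
    have h5 := hij.1
    have h6 := hij.2
    omega
  have hrB₂ : ∀ i ∈ B, i ∉ B₂ → ∀ j ∈ B₂, blockRel α β i j := by
    intro i hi hi₂ j hj
    refine ⟨hα (hup i hi hi₂ j hj).le, ?_⟩
    rw [((memB i).1 hi).1, ((memB j).1 (hB hj)).1]
  obtain ⟨g, hg⟩ := exists_finrank_radical_le_of_arcs (blockRel α β) A A₂ B B₂ hA hB hAB hfull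
    hrA hrA' hrB hrB₂ τ hτA hτB f'
  have hrel : (fun i j : {i // i ∉ A₂} => blockRel α β (i : ι) j ∧
      ¬ ((i : ι) ∈ B ∧ (i : ι) ∉ B₂ ∧ (j : ι) ∈ B₂)) =
      blockRel (fun i : {i // i ∉ A₂} => α i) β' := by
    ext i j
    have h1 := hβa i
    have h2 := hβa j
    have h3 : ((i : ι) ∈ B ∧ (i : ι) ∉ B₂) → β i = β a := fun h => ((memB i).1 h.1).1
    have h4 : (j : ι) ∈ B₂ → β j = β a := fun h => ((memB j).1 (hB h)).1
    have h5 : β j = β a → ((i : ι) ∈ B ∧ (i : ι) ∉ B₂) → ¬ ((j : ι) ∈ B ∧ (j : ι) ∉ B₂) →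
        (j : ι) ∈ B₂ := fun h h' => hrest j j.2 h i h'.1 h'.2
    simp only [blockRel, hβ']
    by_cases hi : (i : ι) ∈ B ∧ (i : ι) ∉ B₂ <;> by_cases hj : (j : ι) ∈ B ∧ (j : ι) ∉ B₂
    · rw [if_pos hi, if_pos hj]
      have := hj.2
      constructor
      · rintro ⟨⟨h, h'⟩, -⟩
        exact ⟨h, by omega⟩
      · rintro ⟨h, h'⟩
        exact ⟨⟨h, by omega⟩, fun h => this h.2.2⟩
    · rw [if_pos hi, if_neg hj]
      have h6 := h3 hi
      constructor
      · rintro ⟨⟨h, h'⟩, h''⟩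
        exact absurd ⟨hi.1, hi.2, h5 (by omega) hi hj⟩ h''
      · rintro ⟨h, h'⟩
        omega
    · rw [if_neg hi, if_pos hj]
      constructor
      · rintro ⟨⟨h, h'⟩, -⟩
        exact ⟨h, by omega⟩
      · rintro ⟨h, h'⟩
        exact ⟨⟨h, by omega⟩, fun h => hi ⟨h.1, h.2.1⟩⟩
    · rw [if_neg hi, if_neg hj]
      constructor
      · rintro ⟨⟨h, h'⟩, -⟩
        exact ⟨h, by omega⟩
      · rintro ⟨h, h'⟩
        exact ⟨⟨h, by omega⟩, fun h => hi ⟨h.1, h.2.1⟩⟩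
  rw [hrel] at hg
  refine ⟨g, (hg.trans hf').trans_lt ?_⟩
  have hlt : 0 < A₂.card := by omega
  rw [Fintype.card_subtype_compl, Fintype.card_coe]
  have := Finset.card_le_univ A₂
  omega

/-- Some linear form on the seaweed in `gl` has a stabilizer of dimension at most the number of
indices, and of strictly smaller dimension if the two block decompositions differ. -/
theorem exists_finrank_radical_blockRel_le [Infinite K] (ι : Type*) [Fintype ι] [LinearOrder ι]
    (α β : ι → ℕ) (hα : Monotone α) (hβ : Monotone β) :
    ∃ f : Matrix ι ι K →ₗ[K] K,
      Module.finrank K (radical (incidence K (blockRel α β)) f) ≤ Fintype.card ι ∧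
      ((∃ i j, ¬ (α i = α j ↔ β i = β j)) →
        Module.finrank K (radical (incidence K (blockRel α β)) f) < Fintype.card ι) := by
  induction hm : Fintype.card ι using Nat.strong_induction_on generalizing ι with
  | _ m ih =>
  subst hm
  have ih' : ∀ (s : Finset ι), s.Nonempty → ∀ α β : {i // i ∉ s} → ℕ, Monotone α → Monotone β →
      ∃ f : Matrix {i // i ∉ s} {i // i ∉ s} K →ₗ[K] K,
        Module.finrank K (radical (incidence K (blockRel α β)) f) ≤
          Fintype.card {i // i ∉ s} := by
    intro s hs α β hα hβ
    have hlt : Fintype.card {i // i ∉ s} < Fintype.card ι := by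
      obtain ⟨i, hi⟩ := hs
      exact Fintype.card_subtype_lt (not_not.2 hi)
    obtain ⟨f, hf, -⟩ := ih _ hlt {i // i ∉ s} α β hα hβ rfl
    exact ⟨f, hf⟩
  rcases isEmpty_or_nonempty ι with hι | hι
  · refine ⟨0, ?_, fun ⟨i, _⟩ => hι.elim i⟩
    rw [Module.finrank_zero_of_subsingleton]
    exact Nat.zero_le _
  obtain ⟨a, ha⟩ : ∃ a : ι, ∀ i, a ≤ i :=
    ⟨Finset.univ.min' Finset.univ_nonempty, fun i => Finset.min'_le _ _ (Finset.mem_univ i)⟩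
  by_cases h1 : ∀ i, α i = α a → β i = β a
  · by_cases h2 : ∃ b, β b = β a ∧ α b ≠ α a
    · obtain ⟨f, hf⟩ := exists_finrank_radical_lt_of_subset α β hα hβ ih' a ha h1 h2
      exact ⟨f, hf.le, fun _ => hf⟩
    · push Not at h2
      have hlt : Fintype.card {i // i ≠ a} < Fintype.card ι :=
        Fintype.card_subtype_lt (not_not.2 rfl)
      obtain ⟨f', hf', hf''⟩ := ih _ hlt {i // i ≠ a} (fun i => α i) (fun i => β i)
        (fun i j hij => hα hij) (fun i j hij => hβ hij) rfl
      obtain ⟨g, hg⟩ := exists_finrank_radical_le_of_isolated (blockRel α β) a (fun i => by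
        have h3 := hα (ha i)
        have h4 := hβ (ha i)
        have h5 := h1 i
        have h6 := h2 i
        rw [blockRel, blockRel]
        omega) f'
      refine ⟨g, hg.trans ((Nat.add_le_add_right hf' 1).trans hlt), ?_⟩
      rintro ⟨i, j, hij⟩
      by_cases hi : i = a
      · have h5 := h1 j
        have h6 := h2 j
        subst hi
        exact absurd ⟨fun h => (h5 h.symm).symm, fun h => (h6 h.symm).symm⟩ hij
      by_cases hj : j = a
      · subst hj
        exact absurd ⟨h1 i, h2 i⟩ hij
      have := hf'' ⟨⟨i, hi⟩, ⟨j, hj⟩, hij⟩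
      exact hg.trans_lt ((Nat.add_lt_add_right this 1).trans_le hlt)
  · push Not at h1
    obtain ⟨b, hb, hb'⟩ := h1
    have h2 : ∀ i, β i = β a → α i = α a := by
      intro i hi
      rcases le_total i b with h | h
      · exact le_antisymm (hb ▸ hα h) (hα (ha i))
      · exact absurd (le_antisymm (hi ▸ hβ h) (hβ (ha b))) hb'
    obtain ⟨f, hf⟩ := exists_finrank_radical_lt_of_subset β α hβ hα
      (fun s hs α β hα hβ => ih' s hs α β hα hβ) a ha h2 ⟨b, hb, hb'⟩
    have hrel : (fun i j => blockRel β α j i) = blockRel α β := by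
      ext i j
      exact and_comm
    rw [← finrank_radical_transpose, hrel] at hf
    exact ⟨_, hf.le, fun _ => hf⟩

end Induction

/-! ### Lower bound for block diagonal algebras -/

section Commuting

open Matrix Polynomial

variable {K : Type*} [Field K]

/-- At `s = 0` the diagonals of the powers form a Vandermonde matrix, so the determinant made of
these diagonals is a nonzero polynomial in `s`. -/
theorem finite_setOf_not_linearIndependent_pow {n : ℕ} (d : Fin n → K)
    (hd : Function.Injective d) (F : Matrix (Fin n) (Fin n) K) :
    {s : K | ¬ LinearIndependent K fun j : Fin n => (diagonal d + s • F) ^ (j : ℕ)}.Finite := by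
  set Y : Matrix (Fin n) (Fin n) K[X] := (diagonal d).map C + (X : K[X]) • F.map C with hY
  set q : K[X] := (Matrix.of fun i j : Fin n => (Y ^ (j : ℕ)) i i).det with hq
  have hYs : ∀ s, Y.map (evalRingHom s) = diagonal d + s • F := by
    intro s
    ext i j
    simp [hY, Matrix.map_apply, -diagonal_map, mul_comm s]
  have hqs : ∀ s, q.eval s =
      (Matrix.of fun i j : Fin n => ((diagonal d + s • F) ^ (j : ℕ)) i i).det := by
    intro s
    rw [← coe_evalRingHom, hq, RingHom.map_det]
    congr 1
    ext i j
    rw [← hYs s, RingHom.mapMatrix_apply, Matrix.map_apply, Matrix.of_apply, Matrix.of_apply,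
      ← RingHom.mapMatrix_apply, ← map_pow, RingHom.mapMatrix_apply, Matrix.map_apply]
  have hq0 : q ≠ 0 := by
    intro h
    have h1 := hqs 0
    rw [h, eval_zero] at h1
    refine (det_vandermonde_ne_zero_iff.2 hd) (h1.trans ?_).symm
    congr 1
    ext i j
    simp [diagonal_pow, vandermonde]
  refine (Polynomial.finite_setOfPred_isRoot hq0).subset fun s hs => ?_
  by_contra hne
  refine hs (Fintype.linearIndependent_iff.2 fun c hc => ?_)
  have hdet : (Matrix.of fun i j : Fin n => ((diagonal d + s • F) ^ (j : ℕ)) i i).det ≠ 0 := by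
    rw [← hqs]; exact hne
  refine congrFun (Matrix.eq_zero_of_mulVec_eq_zero hdet (v := c) ?_)
  ext i
  have := congrFun (congrFun hc i) i
  rw [Matrix.sum_apply] at this
  simpa [mulVec, dotProduct, mul_comm] using this

/-- Every linear form on a block diagonal algebra is `x ↦ trace (F * x)` with `F` block diagonal. For
generic `t` the stabilizer of the form given by `F + t • D`, with `D` diagonal with distinct
entries, contains the linearly independent powers of this matrix. Semicontinuity carries the bound
over to `F`. -/
theorem le_finrank_radical_of_equivalence [Infinite K] {n : ℕ} {r : Fin n → Fin n → Prop}
    (hr : Equivalence r) (f : Matrix (Fin n) (Fin n) K →ₗ[K] K) :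
    n ≤ Module.finrank K (radical (incidence K r) f) := by
  classical
  set d : Fin n → K := fun i => Infinite.natEmbedding K i
  have hd : Function.Injective d := fun i j h => Fin.ext ((Infinite.natEmbedding K).injective h)
  -- the block diagonal matrix that represents `f` through the trace form
  set F : Matrix (Fin n) (Fin n) K := Matrix.of fun i j =>
    if r j i then f (Matrix.single j i 1) else 0 with hF
  set S := incidence K r
  have hfF : ∀ x ∈ S, f x = trace (F * x) := by
    intro x hx
    have h1 : f x = ∑ i, ∑ j, x i j * f (Matrix.single i j 1) := by
      conv_lhs => rw [Matrix.matrix_eq_sum_single x]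
      simp only [map_sum]
      refine Finset.sum_congr rfl fun i _ => Finset.sum_congr rfl fun j _ => ?_
      rw [← smul_eq_mul, ← map_smul, Matrix.smul_single, smul_eq_mul, mul_one]
    rw [h1, trace, Finset.sum_comm]
    refine Finset.sum_congr rfl fun j _ => ?_
    rw [diag_apply, mul_apply]
    refine Finset.sum_congr rfl fun i _ => ?_
    rw [hF, of_apply]
    split_ifs with h
    · exact mul_comm _ _
    · rw [hx i j h, zero_mul, zero_mul]
  have htrans : ∀ i j k, r i j → r j k → r i k := fun _ _ _ => hr.trans
  have hmem : ∀ (s : K) (j : ℕ), (diagonal d + s • F) ^ j ∈ S := by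
    intro s j
    induction j with
    | zero =>
      intro i j hij
      rw [pow_zero]
      exact Matrix.one_apply_ne fun h => hij (h ▸ hr.refl i)
    | succ j ih =>
      rw [pow_succ]
      refine mul_mem_incidence htrans ih fun i j hij => ?_
      have h1 : i ≠ j := fun h => hij (h ▸ hr.refl i)
      have h2 : ¬ r j i := fun h => hij (hr.symm h)
      simp [hF, h1, h2]
  set g : Matrix (Fin n) (Fin n) K →ₗ[K] K :=
    Matrix.traceLinearMap (Fin n) K K ∘ₗ LinearMap.mulLeft K (diagonal d) with hg
  obtain ⟨t, ht⟩ := ((finite_setOf_finrank_radical_lt S f g).union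
    (((finite_setOf_not_linearIndependent_pow d hd F).image Inv.inv).union
      (Set.finite_singleton (0 : K)))).exists_notMem
  simp only [Set.mem_union, Set.mem_ofPred_eq, Set.mem_singleton_iff, not_or, not_lt,
    Set.mem_image, not_exists, not_and] at ht
  obtain ⟨ht1, ht2, ht0⟩ := ht
  -- `F + t • D = t • (D + t⁻¹ • F)`, so the powers of `D + t⁻¹ • F` stabilize the form
  have hli : LinearIndependent K fun j : Fin n => (diagonal d + t⁻¹ • F) ^ (j : ℕ) := by
    by_contra h
    exact ht2 t⁻¹ h (inv_inv t)
  refine le_trans ?_ ht1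
  have hrad : ∀ j : ℕ, (diagonal d + t⁻¹ • F) ^ j ∈ radical S (f + t • g) := by
    intro j
    refine ⟨hmem _ _, fun y hy => ?_⟩
    set x := diagonal d + t⁻¹ • F with hx
    have h1 : F + t • diagonal d = t • x := by
      rw [hx, smul_add, smul_smul, mul_inv_cancel₀ ht0, one_smul, add_comm]
    have h2 : x ^ j * y - y * x ^ j ∈ S :=
      S.sub_mem (mul_mem_incidence htrans (hmem _ _) hy)
        (mul_mem_incidence htrans hy (hmem _ _))
    calc commForm (f + t • g) (x ^ j) y
        = trace ((F + t • diagonal d) * (x ^ j * y - y * x ^ j)) := by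
          rw [commForm_apply, LinearMap.add_apply, hfF _ h2, add_mul, trace_add, smul_mul,
            trace_smul]
          rfl
      _ = t • (trace (x * (x ^ j * y)) - trace (x * (y * x ^ j))) := by
          rw [h1, smul_mul, trace_smul, mul_sub, trace_sub]
      _ = 0 := by
          rw [← mul_assoc x y, trace_mul_comm (x * y), ← mul_assoc, ← mul_assoc, ← pow_succ,
            ← pow_succ', sub_self, smul_zero]
  have := LinearIndependent.fintype_card_le_finrank (R := K)
    (b := fun j : Fin n => (⟨_, hrad j⟩ : radical S (f + t • g)))
    (LinearIndependent.of_comp (Submodule.subtype _) hli)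
  simpa using this

end Commuting

/-! ### Blocks of compositions -/

section Composition

variable {n : ℕ}

theorem val_lt_sizeUpTo_iff (c : Composition n) (k : Fin n) (i : ℕ) :
    (k : ℕ) < c.sizeUpTo i ↔ (c.index k : ℕ) < i := by
  constructor
  · intro h
    by_contra hi
    exact absurd (h.trans_le (c.monotone_sizeUpTo (not_lt.1 hi))) (not_lt.2 (c.sizeUpTo_index_le k))
  · intro h
    exact (c.lt_sizeUpTo_index_succ k).trans_le (c.monotone_sizeUpTo h)

theorem monotone_index (c : Composition n) : Monotone fun k : Fin n => (c.index k : ℕ) := by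
  intro k l hkl
  by_contra h
  have h1 := (val_lt_sizeUpTo_iff c l _).2 (not_le.1 h)
  exact lt_irrefl _ ((val_lt_sizeUpTo_iff c k _).1 (lt_of_le_of_lt hkl h1))

/-- An inner boundary of a composition is a place where consecutive elements lie in different
blocks. -/
theorem mem_boundaries_iff (c : Composition n) (m : Fin (n + 1)) :
    m ∈ c.boundaries ↔ (m : ℕ) = 0 ∨ (m : ℕ) = n ∨
      ∃ k l : Fin n, (k : ℕ) + 1 = m ∧ (l : ℕ) = m ∧ c.index k ≠ c.index l := by
  have hmem : m ∈ c.boundaries ↔ ∃ i : ℕ, i ≤ c.length ∧ c.sizeUpTo i = m := by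
    simp only [Composition.boundaries, Finset.mem_map, Finset.mem_univ, true_and]
    constructor
    · rintro ⟨i, hi⟩
      exact ⟨i, Nat.lt_succ_iff.1 i.2, congrArg Fin.val hi⟩
    · rintro ⟨i, hi, him⟩
      exact ⟨⟨i, Nat.lt_succ_iff.2 hi⟩, Fin.ext him⟩
  rw [hmem]
  constructor
  · rintro ⟨i, hi, him⟩
    by_cases h0 : (m : ℕ) = 0
    · exact Or.inl h0
    by_cases hn : (m : ℕ) = n
    · exact Or.inr (Or.inl hn)
    have hm := m.2
    refine Or.inr (Or.inr ⟨⟨m - 1, by omega⟩, ⟨m, by omega⟩, by simp only; omega, rfl, fun h => ?_⟩)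
    have h1 := (val_lt_sizeUpTo_iff c ⟨m - 1, by omega⟩ i).1 (by simp only; omega)
    rw [h, ← val_lt_sizeUpTo_iff] at h1
    simp only at h1
    omega
  · rintro (h | h | ⟨k, l, hk, hl, hkl⟩)
    · exact ⟨0, Nat.zero_le _, by rw [c.sizeUpTo_zero, h]⟩
    · exact ⟨c.length, le_rfl, by rw [c.sizeUpTo_length, h]⟩
    · refine ⟨c.index l, (c.index l).2.le, le_antisymm (hl ▸ c.sizeUpTo_index_le l) ?_⟩
      have h1 : (c.index k : ℕ) ≤ c.index l := monotone_index c (Fin.le_def.2 (by omega))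
      have h2 := (val_lt_sizeUpTo_iff c k _).2 (lt_of_le_of_ne h1 fun h => hkl (Fin.ext h))
      omega

theorem composition_eq_of_index (a b : Composition n)
    (h : ∀ k l, (a.index k : ℕ) = a.index l ↔ (b.index k : ℕ) = b.index l) : a = b := by
  refine (compositionEquiv n).injective (CompositionAsSet.ext ?_)
  change a.boundaries = b.boundaries
  ext m
  rw [mem_boundaries_iff, mem_boundaries_iff]
  simp only [ne_eq, Fin.ext_iff, h]

end Composition

/-! ### Seaweeds as incidence matrices -/

section Flags

variable {K : Type*} [Field K] {n : ℕ}

theorem mem_span_single_iff (p : Fin n → Prop) (v : Fin n → K) :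
    v ∈ Submodule.span K {v | ∃ k : Fin n, p k ∧ v = Pi.single k (1 : K)} ↔
      ∀ k, ¬ p k → v k = 0 := by
  constructor
  · intro hv k hk
    have hle : Submodule.span K {v | ∃ k : Fin n, p k ∧ v = Pi.single k (1 : K)} ≤
        LinearMap.ker (LinearMap.proj k : (Fin n → K) →ₗ[K] K) := by
      rw [Submodule.span_le]
      rintro _ ⟨l, hl, rfl⟩
      exact Pi.single_eq_of_ne (fun h : k = l => hk (h ▸ hl)) _
    exact hle hv
  · intro h
    rw [pi_eq_sum_univ' v]
    refine Submodule.sum_mem _ fun k _ => ?_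
    by_cases hk : p k
    · refine Submodule.smul_mem _ _ (Submodule.subset_span ⟨k, hk, ?_⟩)
      ext l
      simp [Pi.single_apply, eq_comm]
    · rw [h k hk, zero_smul]
      exact Submodule.zero_mem _

theorem mulVec_mem_span_single_iff (p : Fin n → Prop) (x : Matrix (Fin n) (Fin n) K) :
    (∀ v ∈ Submodule.span K {v | ∃ k : Fin n, p k ∧ v = Pi.single k (1 : K)},
      x.mulVec v ∈ Submodule.span K {v | ∃ k : Fin n, p k ∧ v = Pi.single k (1 : K)}) ↔
      ∀ i j, p j → ¬ p i → x i j = 0 := by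
  simp only [mem_span_single_iff]
  constructor
  · intro h i j hj hi
    have := h (Pi.single j 1) (fun k hk => Pi.single_eq_of_ne (fun h' : k = j => hk (h' ▸ hj)) _) i hi
    simpa using this
  · intro h v hv i hi
    rw [Matrix.mulVec, dotProduct]
    refine Finset.sum_eq_zero fun j _ => ?_
    by_cases hj : p j
    · rw [h i j hj hi, zero_mul]
    · rw [hv j hj, mul_zero]

theorem mem_seaweed_iff (a b : Composition n) (x : LieAlgebra.SpecialLinear.sl (Fin n) K) :
    x ∈ seaweed K a b ↔
      x.1 ∈ incidence K (blockRel (fun k => (a.index k : ℕ)) fun k => (b.index k : ℕ)) := by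
  change ((∀ i, ∀ v ∈ topFlag K a i, x.1.mulVec v ∈ topFlag K a i) ∧
    (∀ j, ∀ w ∈ bottomFlag K b j, x.1.mulVec w ∈ bottomFlag K b j)) ↔ _
  simp only [topFlag, bottomFlag, mulVec_mem_span_single_iff, val_lt_sizeUpTo_iff, ← not_lt,
    mem_incidence, blockRel]
  constructor
  · rintro ⟨h1, h2⟩ i j hij
    by_cases h : (a.index j : ℕ) < a.index i
    · exact h1 (a.index j + 1) i j (by omega) (by omega)
    · exact h2 (b.index j) i j (by omega) (by omega)
  · intro h
    exact ⟨fun k i j hj hi => h i j (by omega), fun k i j hj hi => h i j (by omega)⟩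

end Flags

/-! ### The index of a seaweed in `sl` -/

section Index

open Matrix

variable {K : Type*} [Field K] {n : ℕ}

/-- The inclusion of a seaweed into the space of all matrices. -/
def seaweedIncl (K : Type*) [Field K] {n : ℕ} (a b : Composition n) :
    seaweed K a b →ₗ[K] Matrix (Fin n) (Fin n) K where
  toFun x := x.1.1
  map_add' _ _ := rfl
  map_smul' _ _ := rfl

theorem seaweedIncl_injective (a b : Composition n) :
    Function.Injective (seaweedIncl K a b) := fun _ _ h => Subtype.ext (Subtype.ext h)

theorem mem_range_seaweedIncl (a b : Composition n) (x : Matrix (Fin n) (Fin n) K) :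
    x ∈ LinearMap.range (seaweedIncl K a b) ↔ trace x = 0 ∧
      x ∈ incidence K (blockRel (fun k => (a.index k : ℕ)) fun k => (b.index k : ℕ)) := by
  constructor
  · rintro ⟨y, rfl⟩
    exact ⟨y.1.2, (mem_seaweed_iff a b y.1).1 y.2⟩
  · rintro ⟨h1, h2⟩
    exact ⟨⟨⟨x, h1⟩, (mem_seaweed_iff a b ⟨x, h1⟩).2 h2⟩, rfl⟩

theorem seaweedIncl_lie (a b : Composition n) (x y : seaweed K a b) :
    seaweedIncl K a b ⁅x, y⁆ = seaweedIncl K a b x * seaweedIncl K a b y -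
      seaweedIncl K a b y * seaweedIncl K a b x := rfl

/-- Passing from `gl` to `sl` removes from each stabilizer exactly the line of scalar matrices. -/
theorem finrank_radical_eq_finrank_ker_add_one [CharZero K] (hn : 1 ≤ n) (a b : Composition n)
    (f : Matrix (Fin n) (Fin n) K →ₗ[K] K) :
    Module.finrank K (radical
      (incidence K (blockRel (fun k => (a.index k : ℕ)) fun k => (b.index k : ℕ))) f) =
    Module.finrank K (LinearMap.ker (kirillovForm (f ∘ₗ seaweedIncl K a b))) + 1 := by
  set S := incidence K (blockRel (fun k => (a.index k : ℕ)) fun k => (b.index k : ℕ)) with hS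
  have hn0 : (n : K) ≠ 0 := Nat.cast_ne_zero.2 (by omega)
  have h1S : (1 : Matrix (Fin n) (Fin n) K) ∈ S := fun i j hij =>
    Matrix.one_apply_ne fun h => hij (h ▸ ⟨le_rfl, le_rfl⟩)
  have h1 : (1 : Matrix (Fin n) (Fin n) K) ∈ radical S f := ⟨h1S, fun y _ => by simp⟩
  set T := (traceLinearMap (Fin n) K K).domRestrict (radical S f) with hT
  have hrange : LinearMap.range T = ⊤ := by
    rw [LinearMap.range_eq_top]
    intro c
    refine ⟨(c / n) • ⟨1, h1⟩, ?_⟩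
    rw [map_smul, hT, LinearMap.domRestrict_apply, traceLinearMap_apply, trace_one,
      Fintype.card_fin, smul_eq_mul, div_mul_cancel₀ _ hn0]
  have hrk := LinearMap.finrank_range_add_finrank_ker T
  rw [hrange, finrank_top, Module.finrank_self] at hrk
  rw [← hrk, add_comm]
  congr 1
  have hmap : (LinearMap.ker T).map (radical S f).subtype =
      (LinearMap.ker (kirillovForm (f ∘ₗ seaweedIncl K a b))).map (seaweedIncl K a b) := by
    ext x
    constructor
    · rintro ⟨⟨x, hx⟩, hx0, rfl⟩
      obtain ⟨y, rfl⟩ := (mem_range_seaweedIncl a b x).2 ⟨hx0, hx.1⟩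
      refine ⟨y, ?_, rfl⟩
      rw [SetLike.mem_coe, LinearMap.mem_ker]
      refine LinearMap.ext fun z => ?_
      have := hx.2 _ ((mem_range_seaweedIncl a b _).1 ⟨z, rfl⟩).2
      exact this
    · rintro ⟨x, hx, rfl⟩
      have hx' := (mem_range_seaweedIncl a b _).1 ⟨x, rfl⟩
      refine ⟨⟨seaweedIncl K a b x, hx'.2, fun y hy => ?_⟩, hx'.1, rfl⟩
      -- remove the scalar part of `y`, which is central
      obtain ⟨z, hz⟩ := (mem_range_seaweedIncl a b (y - (trace y / n) • 1)).2
        ⟨by rw [trace_sub, trace_smul, trace_one, Fintype.card_fin, smul_eq_mul,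
            div_mul_cancel₀ _ hn0, sub_self],
          S.sub_mem hy (S.smul_mem _ h1S)⟩
      have h2 : f (seaweedIncl K a b ⁅x, z⁆) = 0 := LinearMap.congr_fun (LinearMap.mem_ker.1 hx) z
      rw [seaweedIncl_lie, hz] at h2
      rw [commForm_apply, ← h2]
      congr 1
      simp [mul_sub, sub_mul]
  rw [← Submodule.finrank_map_subtype_eq, hmap]
  exact (Submodule.equivMapOfInjective _ (seaweedIncl_injective a b) _).finrank_eq.symm

theorem exists_comp_seaweedIncl (a b : Composition n) (f : Module.Dual K (seaweed K a b)) :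
    ∃ g : Matrix (Fin n) (Fin n) K →ₗ[K] K, g ∘ₗ seaweedIncl K a b = f := by
  obtain ⟨G, hG⟩ := LinearMap.exists_leftInverse_of_injective (seaweedIncl K a b)
    (LinearMap.ker_eq_bot.2 (seaweedIncl_injective a b))
  exact ⟨f ∘ₗ G, by rw [LinearMap.comp_assoc, hG, LinearMap.comp_id]⟩

theorem lieIndex_seaweed_eq_iff [CharZero K] (hn : 1 ≤ n) (a b : Composition n) :
    lieIndex K (seaweed K a b) = n - 1 ↔ a = b := by
  obtain ⟨f, hf, hf'⟩ := exists_finrank_radical_blockRel_le (K := K) (Fin n)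
    (fun k => (a.index k : ℕ)) (fun k => (b.index k : ℕ)) (monotone_index a) (monotone_index b)
  rw [Fintype.card_fin] at hf hf'
  rw [finrank_radical_eq_finrank_ker_add_one hn] at hf hf'
  have hle : lieIndex K (seaweed K a b) ≤
      Module.finrank K (LinearMap.ker (kirillovForm (f ∘ₗ seaweedIncl K a b))) :=
    ciInf_le (OrderBot.bddBelow _) _
  constructor
  · intro h
    by_contra hab
    have := hf' (by
      by_contra hne
      push Not at hne
      exact hab (composition_eq_of_index a b hne))
    omega
  · rintro rfl
    refine le_antisymm (by omega) (le_ciInf fun f => ?_)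
    obtain ⟨g, rfl⟩ := exists_comp_seaweedIncl a a f
    have h1 := finrank_radical_eq_finrank_ker_add_one hn a a g
    have heq : Equivalence (blockRel (fun k => (a.index k : ℕ)) fun k => (a.index k : ℕ)) :=
      ⟨fun _ => ⟨le_rfl, le_rfl⟩, fun h => ⟨h.2, h.1⟩,
        fun h h' => ⟨h.1.trans h'.1, h'.2.trans h.2⟩⟩
    have h2 := le_finrank_radical_of_equivalence heq g
    omega

theorem numPairs_pred [CharZero K] (hn : 1 ≤ n) : numPairs K n (n - 1) = 2 ^ (n - 1) := by
  rw [numPairs, ← composition_card n, ← Nat.card_eq_fintype_card]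
  refine Nat.card_congr
    { toFun := fun p => p.1.1
      invFun := fun a => ⟨(a, a), (lieIndex_seaweed_eq_iff hn a a).2 rfl⟩
      left_inv := ?_
      right_inv := fun _ => rfl }
  rintro ⟨⟨a, b⟩, h⟩
  obtain rfl := (lieIndex_seaweed_eq_iff hn a b).1 h
  rfl

end Index

end Seaweed

end

theorem mainTheorem9 (K : Type*) [Field K] [IsAlgClosed K] [CharZero K] :
    (∀ n : ℕ, 1 ≤ n → ∀ a b : Composition n,
      lieIndex K (Seaweed.seaweed K a b) = n - 1 ↔ a = b) ∧
    (∀ n : ℕ, 1 ≤ n → Seaweed.numPairs K n (n - 1) = 2 ^ (n - 1)) ∧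
    PowerSeries.mk (fun n : ℕ => if n = 0 then (0 : ℚ) else (Seaweed.numPairs K n (n - 1) : ℚ)) =
      PowerSeries.X * (1 - 2 * PowerSeries.X)⁻¹ := by
  refine ⟨fun n hn a b => Seaweed.lieIndex_seaweed_eq_iff hn a b,
    fun n hn => Seaweed.numPairs_pred hn, ?_⟩
  have hC : (2 : PowerSeries ℚ) = PowerSeries.C 2 := (map_ofNat PowerSeries.C 2).symm
  rw [PowerSeries.eq_mul_inv_iff_mul_eq (by simp)]
  ext m
  rw [mul_sub, mul_one, map_sub, hC, mul_left_comm, PowerSeries.coeff_C_mul]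
  rcases m with _ | _ | m
  · simp
  · have h1 : Seaweed.numPairs K 1 0 = 1 := Seaweed.numPairs_pred le_rfl
    simp [h1, PowerSeries.coeff_X]
  · rw [PowerSeries.coeff_succ_mul_X, PowerSeries.coeff_mk, PowerSeries.coeff_mk,
      PowerSeries.coeff_X, if_neg (by omega), if_neg (by omega), if_neg (by omega),
      Seaweed.numPairs_pred (by omega), Seaweed.numPairs_pred (by omega)]
    simp [pow_succ]
    ring
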